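/- Let $\Bbbk$ be a field and let $\vec G_{p,q}=\vec A_p\otimes\vec A_q$ be the equi-oriented commutative grid, i.e. the $p\times q$ grid quiver (arrows from each vertex to its right and upper neighbours) with the commutativity relation on every square. Representations are finite-dimensional over $\Bbbk$. An *interval* $I$ of $\vec G_{p,q}$ is a non-empty connected convex full subquiver; $\mathbb I_{p,q}$ is the set of intervals, ordered by containment of vertex sets, and $V_I$ is the interval representation ($\Bbbk$ on the vertices of $I$, $0$ elsewhere, identity maps along the arrows of $I$, zero maps along all other arrows). A vertex of $I$ is *essential* if it is a source or a sink of $I$; $E(I)$ is the set of essential vertices, and $\mathbb E_{\le 2}=\{I\in\mathbb I_{p,q} : \#E(I)\le 2\}$. A *course* is a finite connected quiver $C$ with a map $F\colon C_0\to(\vec G_{p,q})_0$ such that for each arrow $a\to b$ of $C$ there is a path from $F(a)$ to $F(b)$; it is *essential in $I$* if $E(I)\subseteq F(C_0)\subseteq I_0$, where $I_0$ is the vertex set of $I$. For a representation $M$ of $\vec G_{p,q}$, $\operatorname{tour}_{(C,F)}(M)$ is the representation of $C$ with spaces $M_{F(a)}$ and, at an arrow $a\to b$, the map $M(F(a)\to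 F(b))$. An *essential assignment* $\xi$ on a set $\mathbb I'\subseteq\mathbb I_{p,q}$ assigns to each $I\in\mathbb I'$ a course $\xi(I)$ essential in $I$. The *$\xi$-compressed multiplicity* $c^\xi_M(I)$ is the multiplicity of $\operatorname{tour}_{\xi(I)}(V_I)$ in the decomposition of $\operatorname{tour}_{\xi(I)}(M)$ into indecomposables. A *partial interval approximation* of $M$ by $\mathbb I'$ is a function ${}_{\mathbb I'}\delta^\xi_M\colon\mathbb I'\to\mathbb Z$ such that $$c^\xi_M(I)=\sum_{I\le J\in\mathbb I'}{}_{\mathbb I'}\delta^\xi_M(J)\qquad\text{for all } I\in\mathbb I'.$$ It is *rank invariant* if for every path $w$ in $\vec G_{p,q}$ (including trivial paths) $$\operatorname{rank} M(w)=\sum_{J\in\mathbb I'}{}_{\mathbb I'}\delta^\xi_M(J)\cdot\operatorname{rank} V_J(w).$$ **Corollary.** Let $M$ be a representation of $\vec G_{p,q}$, let $\mathbb I'\subseteq\mathbb I_{p,q}$, and let $\xi$ be an essential assignment on $\mathbb I'$. If $\mathbb E_{\le 2}\subseteq\mathbb I'$, then the partial interval approximation ${}_{\mathbb I'}\delta^\xi_M$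 is rank invariant. In particular, for every essential assignment $\xi$ on $\mathbb E_{\le 2}$, the rectangle approximation ${}_{\mathbb E_{\le 2}}\delta^\xi_M$ is rank invariant. -/

import Mathlib

universe u v w v' w'

noncomputable section

namespace IntervalApprox

open CategoryTheory CategoryTheory.Limits

/-! ## Quivers: underlying graphs, intervals, essential vertices -/

section Quivers

variable {V : Type w} [Quiver.{v} V]

/-- The underlying (undirected, simple) graph of a quiver. -/
def underlyingGraph (V : Type w) [Quiver.{v} V] : SimpleGraph V :=
  SimpleGraph.fromRel fun a b => Nonempty (a ⟶ b)

/-- An interval subquiver of a commutative quiver (one without zero relations): a (nonempty)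
connected convex full subquiver. A full subquiver is recorded by its set of vertices. -/
@[ext]
structure IntervalSubquiver (V : Type w) [Quiver.{v} V] where
  /-- The vertex set. -/
  verts : Set V
  connected : ((underlyingGraph V).induce verts).Connected
  /-- Every vertex on a path that starts and ends in the subquiver is in the subquiver. -/
  convex : ∀ ⦃a b c : V⦄, a ∈ verts → c ∈ verts →
    Nonempty (Quiver.Path a b) → Nonempty (Quiver.Path b c) → b ∈ verts

/-- Intervals are ordered by containment of their vertex sets. -/
instance : PartialOrder (IntervalSubquiver V) :=
  PartialOrder.lift IntervalSubquiver.verts fun _ _ h => IntervalSubquiver.ext h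

instance [Finite V] : Finite (IntervalSubquiver V) :=
  Finite.of_injective IntervalSubquiver.verts fun _ _ h => IntervalSubquiver.ext h

instance [Finite V] : Fintype (IntervalSubquiver V) := Fintype.ofFinite _

/-- `a` is a source of the interval `I`: no arrow of `I` points to it. -/
def IntervalSubquiver.IsSource (I : IntervalSubquiver V) (a : V) : Prop :=
  a ∈ I.verts ∧ ∀ b ∈ I.verts, IsEmpty (b ⟶ a)

/-- `a` is a sink of the interval `I`: no arrow of `I` originates from it. -/
def IntervalSubquiver.IsSink (I : IntervalSubquiver V) (a : V) : Prop :=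
  a ∈ I.verts ∧ ∀ b ∈ I.verts, IsEmpty (a ⟶ b)

/-- The set `E(I)` of essential vertices of `I`: its sources and its sinks. -/
def IntervalSubquiver.essential (I : IntervalSubquiver V) : Set V :=
  {a | I.IsSource a ∨ I.IsSink a}

/-- The intervals with exactly `n` essential vertices. -/
def essentialIntervals (V : Type w) [Quiver.{v} V] (n : ℕ) : Set (IntervalSubquiver V) :=
  {I | I.essential.ncard = n}

/-- The intervals with `i` essential vertices for some `1 ≤ i ≤ n`. -/
def essentialIntervalsLE (V : Type w) [Quiver.{v} V] (n : ℕ) : Set (IntervalSubquiver V) :=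
  ⋃ i ∈ Set.Icc 1 n, essentialIntervals V i

/-! ## Courses and essential assignments -/

/-- A course on a quiver `V`: a connected finite quiver `C` with a labeling map `F` from its
vertices to those of `V`, such that for every arrow `a ⟶ b` of `C` there is a path in `V` from
`F a` to `F b`. (Only the vertex set of `C` has to be finite, and `C` may have cycles.) -/
structure Course (V : Type w) [Quiver.{v} V] where
  /-- The vertices of the shape `C`. -/
  Shape : Type w'
  [quiver : Quiver.{v'} Shape]
  [finite : Finite Shape]
  connected : (underlyingGraph Shape).Connected
  /-- The labeling map `F`. -/
  label : Shape → V
  exists_path : ∀ ⦃a b : Shape⦄, (a ⟶ b) → Nonempty (Quiver.Path (label a) (label b))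

attribute [instance] Course.quiver Course.finite

/-- A course is essential in `I` if it stays in `I` and visits all essential vertices of `I`. -/
def Course.IsEssentialIn (c : Course.{v, w, v', w'} V) (I : IntervalSubquiver V) : Prop :=
  I.essential ⊆ Set.range c.label ∧ Set.range c.label ⊆ I.verts

/-- An essential assignment defined on a set `S` of intervals: it assigns to every `I ∈ S` an
essential course in `I`. -/
structure EssentialAssignment (S : Set (IntervalSubquiver V)) where
  /-- The course assigned to an interval. -/
  course : S → Course.{v, w, v', w'} V
  essential : ∀ I : S, (course I).IsEssentialIn I.1

end Quivers

/-! ## Representations and multiplicities -/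

section Representations

variable (k : Type u) [Field k]

/-- The finite-dimensional representations of a quiver `V` (without relations): functors from the
path category of `V` to finite-dimensional vector spaces. -/
abbrev QuiverRep (V : Type w) [Quiver.{v} V] := Paths V ⥤ FGModuleCat.{u} k

variable {k} {V : Type w} [Quiver.{v} V]

/-- The evaluation `M(p)` of a representation on a path, as a linear map. -/
def QuiverRep.eval (M : QuiverRep k V) {a b : V} (p : Quiver.Path a b) :
    (M.obj a : Type u) →ₗ[k] (M.obj b : Type u) :=
  (M.map (X := a) (Y := b) p).hom.hom

/-- The rank of `M(p)`. -/
def QuiverRep.rank (M : QuiverRep k V) {a b : V} (p : Quiver.Path a b) : ℕ :=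
  Module.finrank k (LinearMap.range (QuiverRep.eval M p))

instance : HasFiniteBiproducts (QuiverRep k V) := HasFiniteBiproducts.of_hasFiniteProducts

/-- A decomposition of a representation into finitely many indecomposable ones. -/
structure IndecomposableDecomposition (N : QuiverRep k V) where
  /-- The number of summands. -/
  card : ℕ
  /-- The summands. -/
  summand : Fin card → QuiverRep k V
  indecomposable : ∀ i, Indecomposable (summand i)
  iso : N ≅ ⨁ summand

open Classical in
/-- The multiplicity `d_N(L)` of an indecomposable representation `L` in `N`: the number of
summands isomorphic to `L` in a decomposition of `N` into indecomposables. For quivers with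
finitely many vertices a decomposition always exists, and by the Krull-Schmidt theorem the number
does not depend on it. -/
def summandMultiplicity (N L : QuiverRep k V) : ℕ :=
  if h : Nonempty (IndecomposableDecomposition N) then
    Nat.card {i : Fin h.some.card // Nonempty (h.some.summand i ≅ L)}
  else 0

/-- The tour of a representation `M` on the course `c`: the representation of the shape of `c` with
the space `M_{F(a)}` at the vertex `a` and, at the arrow `a ⟶ b`, the evaluation of `M` on a path
from `F(a)` to `F(b)`. (If parallel paths act equally on `M`, the choice of the path does not
matter.) -/
def tour (c : Course.{v, w, v', w'} V) (M : QuiverRep k V) : QuiverRep k c.Shape :=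
  Paths.lift
    { obj := fun a => M.obj (c.label a)
      map := fun {a b} α =>
        M.map (X := c.label a) (Y := c.label b) (Classical.choice (c.exists_path α)) }

open Classical in
/-- The representation with `k` at every vertex of `I` and `0` elsewhere, and with the identity of
`k` at every arrow within `I` and `0` at all other arrows. The space at `a` is realised as
the space of functions from the proofs of `a ∈ I` to `k`, which is `k` if `a ∈ I` and `0` if not. -/
def indicatorRep (k : Type u) [Field k] (I : Set V) : QuiverRep k V :=
  Paths.lift
    { obj := fun a => FGModuleCat.of k (PLift (a ∈ I) → k)
      map := fun {a b} _ => FGModuleCat.ofHom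
        { toFun := fun f _ => if h : a ∈ I then f ⟨h⟩ else 0
          map_add' := by intro f g; funext; by_cases h : a ∈ I <;> simp [h]
          map_smul' := by intro r f; funext; by_cases h : a ∈ I <;> simp [h] } }

end Representations

/-! ## Tensor products of quivers and commutative grids -/

section Tensor

/-- The vertices of the Cartesian product of two quivers. -/
@[ext]
structure QuiverProd (V : Type w) (W : Type w') where
  /-- The first coordinate. -/
  fst : V
  /-- The second coordinate. -/
  snd : W

/-- The arrows of the Cartesian product of two quivers. -/
inductive QuiverProd.Arrow {V : Type w} {W : Type w'} [Quiver.{v} V] [Quiver.{v'} W] :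
    QuiverProd V W → QuiverProd V W → Type (max v v' w w')
  | left {a b : V} (α : a ⟶ b) (c : W) : Arrow ⟨a, c⟩ ⟨b, c⟩
  | right (a : V) {c d : W} (β : c ⟶ d) : Arrow ⟨a, c⟩ ⟨a, d⟩

instance {V : Type w} {W : Type w'} [Quiver.{v} V] [Quiver.{v'} W] : Quiver (QuiverProd V W) :=
  ⟨QuiverProd.Arrow⟩

instance {V : Type w} {W : Type w'} [Finite V] [Finite W] : Finite (QuiverProd V W) :=
  Finite.of_injective (fun x => (x.fst, x.snd)) fun x y h => by
    cases x; cases y; simpa using h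

variable {V : Type w} {W : Type w'} [Quiver.{v} V] [Quiver.{v'} W]

/-- The path `(a, c) ⟶ (b, c) ⟶ (b, d)`. -/
def QuiverProd.leftRight {a b : V} {c d : W} (α : a ⟶ b) (β : c ⟶ d) :
    Quiver.Path (⟨a, c⟩ : QuiverProd V W) ⟨b, d⟩ :=
  (Quiver.Path.nil.cons (QuiverProd.Arrow.left α c : _ ⟶ _)).cons
    (QuiverProd.Arrow.right b β : _ ⟶ _)

/-- The path `(a, c) ⟶ (a, d) ⟶ (b, d)`. -/
def QuiverProd.rightLeft {a b : V} {c d : W} (α : a ⟶ b) (β : c ⟶ d) :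
    Quiver.Path (⟨a, c⟩ : QuiverProd V W) ⟨b, d⟩ :=
  (Quiver.Path.nil.cons (QuiverProd.Arrow.right a β : _ ⟶ _)).cons
    (QuiverProd.Arrow.left α d : _ ⟶ _)

/-- The finite-dimensional representations of the tensor product of `V` and `W`, which is the
Cartesian product with the commutativity relations on all squares `α × β`. -/
structure TensorRep (k : Type u) [Field k] (V : Type w) (W : Type w')
    [Quiver.{v} V] [Quiver.{v'} W] where
  /-- The underlying representation of the Cartesian product. -/
  toRep : QuiverRep k (QuiverProd V W)
  comm : ∀ {a b : V} {c d : W} (α : a ⟶ b) (β : c ⟶ d),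
    QuiverRep.eval toRep (QuiverProd.leftRight α β) =
      QuiverRep.eval toRep (QuiverProd.rightLeft α β)

/-- The interval representation `V_I` of an interval `I` of a tensor product. -/
def intervalRep (k : Type u) [Field k] (I : IntervalSubquiver (QuiverProd V W)) :
    TensorRep k V W where
  toRep := indicatorRep k I.verts
  comm := by
    classical
    intro a b c d α β
    have key : ∀ {x y z : QuiverProd V W} (f : x ⟶ y) (g : y ⟶ z),
        QuiverRep.eval (indicatorRep k I.verts) ((Quiver.Path.nil.cons f).cons g) =
          LinearMap.pi fun hz : PLift (z ∈ I.verts) =>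
            if h : x ∈ I.verts then LinearMap.proj ⟨h⟩ else 0 := by
      intro x y z f g
      apply LinearMap.ext
      intro φ
      funext hz
      change (if h : y ∈ I.verts then (if h : x ∈ I.verts then φ ⟨h⟩ else 0) else 0) =
        (if h : x ∈ I.verts then LinearMap.proj ⟨h⟩ else 0 :
          (PLift (x ∈ I.verts) → k) →ₗ[k] k) φ
      by_cases hx : x ∈ I.verts
      · have hy : y ∈ I.verts := I.convex hx hz.down ⟨f.toPath⟩ ⟨g.toPath⟩
        simp [hx, hy]
      · simp only [hx, dite_false, dite_eq_ite, ite_self]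
        rfl
    exact (key _ _).trans (key _ _).symm

/-- The vertices of the equi-oriented quiver `1 ⟶ 2 ⟶ ⋯ ⟶ n` of type `A_n`. -/
structure LinearQuiver (n : ℕ) where
  /-- The position, counted from `0`. -/
  pos : Fin n

/-- There is exactly one arrow from each vertex to the next one. -/
instance (n : ℕ) : Quiver.{0} (LinearQuiver n) :=
  ⟨fun a b => PLift (a.pos.val + 1 = b.pos.val)⟩

instance (n : ℕ) : Finite (LinearQuiver n) :=
  Finite.of_injective LinearQuiver.pos fun x y h => by cases x; cases y; simpa using h

/-- The underlying quiver of the equi-oriented commutative grid with `p` columns and `q` rows. -/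
abbrev Grid (p q : ℕ) := QuiverProd (LinearQuiver p) (LinearQuiver q)

/-- The representations of the equi-oriented commutative grid. -/
abbrev GridRep (k : Type u) [Field k] (p q : ℕ) := TensorRep k (LinearQuiver p) (LinearQuiver q)

end Tensor

/-! ## Partial interval approximations -/

section Approximation

variable {k : Type u} [Field k] {p q : ℕ} {S : Set (IntervalSubquiver (Grid p q))}

/-- The `ξ`-compressed multiplicity of `M` on the interval `I`: the multiplicity of the tour of
`V_I` on `ξ(I)` in the tour of `M` on `ξ(I)`. -/
def compressedMultiplicity (ξ : EssentialAssignment.{_, _, v', w'} S) (M : GridRep k p q)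
    (I : S) : ℕ :=
  summandMultiplicity (tour (ξ.course I) M.toRep) (tour (ξ.course I) (intervalRep k I.1).toRep)

open Classical in
/-- `δ : S → ℤ` is a partial interval approximation of `M` by `S` via `ξ`-compressed
multiplicities: `c_M(I)` is the sum of the `δ(J)` over the `J ∈ S` with `I ≤ J`. -/
def IsPartialIntervalApproximation (ξ : EssentialAssignment.{_, _, v', w'} S)
    (M : GridRep k p q) (δ : S → ℤ) : Prop :=
  ∀ I : S, (compressedMultiplicity ξ M I : ℤ) = ∑ J : S with I.1 ≤ J.1, δ J

open Classical in
/-- A function `δ : S → ℤ` is rank invariant for `M` if the rank of `M` over every path is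
the sum, weighted by `δ`, of the ranks of the interval representations over that path. -/
def IsRankInvariant (M : GridRep k p q) (δ : S → ℤ) : Prop :=
  ∀ ⦃a b : Grid p q⦄ (x : Quiver.Path a b),
    (QuiverRep.rank M.toRep x : ℤ) =
      ∑ J : S, δ J * (QuiverRep.rank (intervalRep k J.1).toRep x : ℤ)

/-- A rectangle approximation of `M`: a partial interval approximation by the set of the intervals
with at most two essential vertices. -/
def IsRectangleApproximation
    (ξ : EssentialAssignment.{_, _, v', w'} (essentialIntervalsLE (Grid p q) 2))
    (M : GridRep k p q) (δ : essentialIntervalsLE (Grid p q) 2 → ℤ) : Prop :=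
  IsPartialIntervalApproximation ξ M δ

end Approximation

end IntervalApprox

end

noncomputable section

namespace IntervalApprox

open CategoryTheory CategoryTheory.Limits

/-! ## Decompositions into indecomposable objects -/

section Decomposition

variable {C : Type u} [Category.{v} C] [Preadditive C] [HasFiniteBiproducts C]
  [HasBinaryBiproducts C]

/-! For a path `x` from `a` to `b`, let `I` be the segment of all vertices between `a` and `b`. The
grid has no oriented cycles, so the essential vertices of `I` are exactly `a` and `b`, and `I` lies
in every `S` that contains the intervals with at most two essential vertices. By convexity, `I ≤ J`
holds iff `J` contains `a` and `b`, that is, iff `V_J` has rank one along `x` (`segment_le_iff`,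
`rank_indicatorRep`); otherwise that rank is zero. The defining equation of the approximation at `I`
is therefore the rank formula for `x`, once the compressed multiplicity of `M` at `I` is known to be
the rank of `M` along `x`.

That identity is the core (`summandMultiplicity_tour`). A course essential in `I` stays in `I` and
visits `a` and `b`, so the tour of `V_I` is the constant representation, whose endomorphisms are
scalars because the course is connected. Pairing the morphisms from the constant representation to
the tour of `M` with those back gives scalars. The largest identity matrix so obtained has as its
size the number of constant summands, and also the rank of `M` from `a` to `b`, since `M` does not
distinguish parallel paths (`GridRep.eval_eq`). The count is thus found for an arbitrary
decomposition into indecomposables, and uniqueness as in Krull-Schmidt is never used. -/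

/-- The biproduct of two finite biproducts is the biproduct of the joint family. -/
theorem nonempty_biprod_biproduct_iso {ι κ : Type} [Fintype ι] [Fintype κ] (f : ι → C)
    (g : κ → C) : Nonempty ((⨁ f) ⊞ (⨁ g) ≅ ⨁ (Sum.elim f g)) := by
  classical
  let b : Bicone (Sum.elim f g) :=
    { pt := (⨁ f) ⊞ (⨁ g)
      π := fun j => match j with
        | .inl i => biprod.fst ≫ biproduct.π f i
        | .inr i => biprod.snd ≫ biproduct.π g i
      ι := fun j => match j with
        | .inl i => biproduct.ι f i ≫ biprod.inl
        | .inr i => biproduct.ι g i ≫ biprod.inr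
      ι_π := by
        rintro (i | i) (j | j)
        · by_cases h : i = j
          · subst h; simp; rfl
          · simp [h]; rfl
        · simp; rfl
        · simp; rfl
        · by_cases h : i = j
          · subst h; simp; rfl
          · simp [h]; rfl }
  have total : ∑ j, b.π j ≫ b.ι j = 𝟙 b.pt := by
    rw [Fintype.sum_sum_type]
    have h1 : ∑ i, biproduct.π f i ≫ biproduct.ι f i = 𝟙 (⨁ f) := biproduct.total
    have h2 : ∑ i, biproduct.π g i ≫ biproduct.ι g i = 𝟙 (⨁ g) := biproduct.total
    have h3 : ∑ i, b.π (.inl i) ≫ b.ι (.inl i) = biprod.fst ≫ biprod.inl := by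
      have : ∀ i, b.π (.inl i) ≫ b.ι (.inl i) =
        biprod.fst ≫ (biproduct.π f i ≫ biproduct.ι f i) ≫ biprod.inl := by
        intro i; simp [b]
      rw [Finset.sum_congr rfl fun i _ => this i, ← Preadditive.comp_sum,
        ← Preadditive.sum_comp, h1, Category.id_comp]
    have h4 : ∑ i, b.π (.inr i) ≫ b.ι (.inr i) = biprod.snd ≫ biprod.inr := by
      have : ∀ i, b.π (.inr i) ≫ b.ι (.inr i) =
        biprod.snd ≫ (biproduct.π g i ≫ biproduct.ι g i) ≫ biprod.inr := by
        intro i; simp [b]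
      rw [Finset.sum_congr rfl fun i _ => this i, ← Preadditive.comp_sum,
        ← Preadditive.sum_comp, h2, Category.id_comp]
    rw [h3, h4, biprod.total]
  exact ⟨biproduct.uniqueUpToIso _ (isBilimitOfTotal b total)⟩

/-- If there is an additive dimension that is positive on nonzero objects, then every object is a
finite biproduct of indecomposable ones. -/
theorem exists_iso_biproduct_indecomposable (dim : C → ℕ)
    (dim_biprod : ∀ {X Y Z : C}, (X ≅ Y ⊞ Z) → dim X = dim Y + dim Z)
    (isZero_of_dim : ∀ X, dim X = 0 → IsZero X) (X : C) :
    ∃ (ι : Type) (_ : Fintype ι) (f : ι → C),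
      (∀ i, Indecomposable (f i)) ∧ Nonempty (X ≅ ⨁ f) := by
  induction h : dim X using Nat.strong_induction_on generalizing X with
  | _ n ih =>
    subst h
    by_cases h0 : IsZero X
    · refine ⟨Empty, inferInstance, Empty.elim, fun i => i.elim, ⟨h0.iso ?_⟩⟩
      rw [IsZero.iff_id_eq_zero]
      ext i
      exact i.elim
    by_cases hI : Indecomposable X
    · exact ⟨Unit, inferInstance, fun _ => X, fun _ => hI,
        ⟨(biproductUniqueIso fun _ : Unit => X).symm⟩⟩
    simp only [Indecomposable, not_and, not_forall, not_or] at hI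
    obtain ⟨Y, Z, e, hY, hZ⟩ := hI h0
    have hd := dim_biprod e
    have hY' : dim Y ≠ 0 := fun h => hY (isZero_of_dim _ h)
    have hZ' : dim Z ≠ 0 := fun h => hZ (isZero_of_dim _ h)
    obtain ⟨ι, _, f, hf, ⟨ef⟩⟩ := ih (dim Y) (by omega) Y rfl
    obtain ⟨κ, _, g, hg, ⟨eg⟩⟩ := ih (dim Z) (by omega) Z rfl
    obtain ⟨e'⟩ := nonempty_biprod_biproduct_iso f g
    refine ⟨ι ⊕ κ, inferInstance, Sum.elim f g, ?_, ⟨e ≪≫ biprod.mapIso ef eg ≪≫ e'⟩⟩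
    rintro (i | i)
    exacts [hf i, hg i]

/-- A nonzero retract of an indecomposable object is isomorphic to it. -/
theorem Indecomposable.nonempty_iso_of_retract {A : Type u} [Category.{v} A] [Abelian A]
    {X K : A} (hX : Indecomposable X) (hK : ¬ IsZero K) (s : K ⟶ X) (t : X ⟶ K)
    (h : s ≫ t = 𝟙 K) : Nonempty (X ≅ K) := by
  have : IsSplitMono s := ⟨⟨⟨t, h⟩⟩⟩
  let c := cokernelIsCokernel s
  -- The split mono `s` yields `X ≅ K ⊞ cokernel s`. Indecomposability kills the cokernel, so `s` is
  -- also epi.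
  let e := biprod.uniqueUpToIso _ _ (isBilimitBinaryBiconeOfIsSplitMonoOfCokernel c)
  have hZ : IsZero (cokernel s) := (hX.2 _ _ e).resolve_left hK
  have : Epi s := Preadditive.epi_of_isZero_cokernel s hZ
  have : IsIso s := isIso_of_epi_of_isSplitMono s
  exact ⟨(asIso s).symm⟩

end Decomposition

/-! ## Linear algebra of quiver representations -/

section Representations

variable {k : Type u} [Field k] {V : Type w} [Quiver.{v} V]

/-- The component of a morphism of representations at a vertex, as a linear map. -/
def QuiverRep.appHom {X Y : QuiverRep k V} (f : X ⟶ Y) (a : V) :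
    (X.obj a : Type u) →ₗ[k] (Y.obj a : Type u) :=
  (f.app a).hom.hom

open QuiverRep

theorem QuiverRep.hom_ext {X Y : QuiverRep k V} {f g : X ⟶ Y}
    (h : ∀ a, appHom f a = appHom g a) : f = g := by
  apply NatTrans.ext
  funext a
  exact FGModuleCat.hom_ext (h a)

theorem QuiverRep.appHom_eval {X Y : QuiverRep k V} (f : X ⟶ Y) {a b : V} (x : Quiver.Path a b)
    (m : (X.obj a : Type u)) : appHom f b (eval X x m) = eval Y x (appHom f a m) :=
  congrArg (fun g : X.obj a ⟶ Y.obj b => g.hom.hom m) (f.naturality (X := a) (Y := b) x)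

theorem QuiverRep.eval_nil (X : QuiverRep k V) (a : V) :
    eval X (Quiver.Path.nil : Quiver.Path a a) = LinearMap.id :=
  congrArg (fun f : X.obj a ⟶ X.obj a => f.hom.hom) (X.map_id a)

theorem QuiverRep.eval_comp (X : QuiverRep k V) {a b c : V} (x : Quiver.Path a b)
    (y : Quiver.Path b c) : eval X (x.comp y) = eval X y ∘ₗ eval X x :=
  congrArg (fun f : X.obj a ⟶ X.obj c => f.hom.hom) (X.map_comp (X := a) (Y := b) (Z := c) x y)

/-- A family of linear maps that is compatible with the arrows is a morphism. -/
def QuiverRep.homMk {X Y : QuiverRep k V}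
    (φ : ∀ a : V, (X.obj a : Type u) →ₗ[k] (Y.obj a : Type u))
    (h : ∀ {a b : V} (α : a ⟶ b), φ b ∘ₗ eval X α.toPath = eval Y α.toPath ∘ₗ φ a) : X ⟶ Y where
  app a := FGModuleCat.ofHom (φ a)
  naturality := by
    have key : ∀ {a b : V} (x : Quiver.Path a b), φ b ∘ₗ eval X x = eval Y x ∘ₗ φ a := by
      intro a b x
      induction x with
      | nil => simp [eval_nil]
      | cons x α ih =>
        change φ _ ∘ₗ eval X (x.comp α.toPath) = eval Y (x.comp α.toPath) ∘ₗ φ a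
        rw [eval_comp, eval_comp, ← LinearMap.comp_assoc, h, LinearMap.comp_assoc, ih,
          LinearMap.comp_assoc]
    intro a b x
    exact FGModuleCat.hom_ext (key x)

theorem QuiverRep.isZero_of_subsingleton (X : QuiverRep k V)
    (h : ∀ a : V, Subsingleton (X.obj a : Type u)) : IsZero X := by
  rw [IsZero.iff_id_eq_zero]
  exact hom_ext fun a => LinearMap.ext fun m => (h a).elim _ _

/-- This supplies the additive dimension for `exists_iso_biproduct_indecomposable`. The identities
between inclusions and projections are evaluated at `a`, so the biproduct need not be computed
vertexwise. -/
theorem QuiverRep.finrank_eq_add {X Y Z : QuiverRep k V} (e : X ≅ Y ⊞ Z) (a : V) :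
    Module.finrank k (X.obj a : Type u) =
      Module.finrank k (Y.obj a : Type u) + Module.finrank k (Z.obj a : Type u) := by
  rw [← Module.finrank_prod]
  have h1 : e.hom ≫ e.inv = 𝟙 X := e.hom_inv_id
  refine LinearEquiv.finrank_eq (LinearEquiv.ofLinearMap
    ((appHom (e.hom ≫ biprod.fst) a).prod (appHom (e.hom ≫ biprod.snd) a))
    ((appHom (biprod.inl ≫ e.inv) a).coprod (appHom (biprod.inr ≫ e.inv) a)) ?_ ?_)
  · have h11 := congrArg (appHom · a) (show
      (biprod.inl ≫ e.inv) ≫ e.hom ≫ biprod.fst = 𝟙 Y by simp)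
    have h12 := congrArg (appHom · a) (show
      (biprod.inl ≫ e.inv) ≫ e.hom ≫ (biprod.snd : Y ⊞ Z ⟶ Z) = 0 by simp)
    have h21 := congrArg (appHom · a) (show
      (biprod.inr ≫ e.inv) ≫ e.hom ≫ (biprod.fst : Y ⊞ Z ⟶ Y) = 0 by simp)
    have h22 := congrArg (appHom · a) (show
      (biprod.inr ≫ e.inv) ≫ e.hom ≫ biprod.snd = 𝟙 Z by simp)
    ext m
    · simp
      exact DFunLike.congr_fun h11 m
    · simp
      exact DFunLike.congr_fun h12 m
    · simp
      exact DFunLike.congr_fun h21 m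
    · simp
      exact DFunLike.congr_fun h22 m
  · have h := congrArg (appHom · a) (show (e.hom ≫ biprod.fst) ≫ (biprod.inl ≫ e.inv) +
      (e.hom ≫ biprod.snd) ≫ (biprod.inr ≫ e.inv) = 𝟙 X by
        have := biprod.total (X := Y) (Y := Z)
        calc _ = e.hom ≫ (biprod.fst ≫ biprod.inl + biprod.snd ≫ biprod.inr) ≫ e.inv := by
              simp only [Category.assoc, Preadditive.add_comp, Preadditive.comp_add]
          _ = _ := by rw [this]; simp)
    ext m
    exact DFunLike.congr_fun h m

/-- Every representation of a quiver with finitely many vertices is a finite direct sum of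
indecomposable representations. -/
theorem nonempty_indecomposableDecomposition [Finite V] (N : QuiverRep k V) :
    Nonempty (IndecomposableDecomposition N) := by
  have := Fintype.ofFinite V
  obtain ⟨ι, _, f, hf, ⟨e⟩⟩ := exists_iso_biproduct_indecomposable
    (fun X : QuiverRep k V => ∑ a : V, Module.finrank k (X.obj a : Type u))
    (fun e =>
      (Finset.sum_congr rfl fun a _ => finrank_eq_add e a).trans Finset.sum_add_distrib)
    (fun X h => isZero_of_subsingleton X fun a => by
      have := Finset.sum_eq_zero_iff.1 h a (Finset.mem_univ a)
      exact Module.finrank_zero_iff.1 this) N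
  exact ⟨⟨Fintype.card ι, f ∘ (Fintype.equivFin ι).symm, fun i => hf _,
    e ≪≫ (biproduct.reindex (Fintype.equivFin ι).symm f).symm⟩⟩

end Representations

/-! ## The multiplicity of the constant representation -/

section ConstRep

/-- A function on a connected quiver that is constant along arrows is constant. -/
theorem eq_of_connected {V : Type w} [Quiver.{v} V] {T : Type*}
    (hV : (underlyingGraph V).Connected) (g : V → T)
    (hg : ∀ {a b : V}, (a ⟶ b) → g a = g b) (a b : V) : g a = g b := by
  obtain ⟨p⟩ := hV.preconnected a b
  induction p with
  | nil => rfl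
  | cons h _ ih =>
    rw [← ih]
    rcases ((SimpleGraph.fromRel_adj _ _ _).1 h).2 with ⟨⟨α⟩⟩ | ⟨⟨α⟩⟩
    exacts [hg α, (hg α).symm]

variable {k : Type u} [Field k] {V : Type w} [Quiver.{v} V]

variable (k V) in
/-- The representation with `k` at every vertex and the identity at every arrow. -/
def constRep : QuiverRep k V := (Functor.const (Paths V)).obj (FGModuleCat.of k k)

open QuiverRep

/-- The element at the vertex `a` that is picked out by a morphism from the constant
representation. -/
def elementAt {X : QuiverRep k V} (f : constRep k V ⟶ X) (a : V) : (X.obj a : Type u) :=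
  appHom f a (1 : k)

theorem eval_elementAt {X : QuiverRep k V} (f : constRep k V ⟶ X) {a b : V}
    (x : Quiver.Path a b) : eval X x (elementAt f a) = elementAt f b :=
  (appHom_eval f x (1 : k)).symm

/-- The scalar by which an endomorphism of the constant representation acts at a vertex. -/
def scalarAt (f : constRep k V ⟶ constRep k V) (a : V) : k := elementAt f a

theorem appHom_constRep (f : constRep k V ⟶ constRep k V) (a : V) (z : k) :
    appHom f a z = z * scalarAt f a := by
  have h : ∀ g : k →ₗ[k] k, g z = z * g 1 := fun g => by
    rw [← smul_eq_mul, ← map_smul, smul_eq_mul, mul_one]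
  exact h (appHom f a)

theorem scalarAt_comp (f g : constRep k V ⟶ constRep k V) (a : V) :
    scalarAt (f ≫ g) a = scalarAt f a * scalarAt g a :=
  appHom_constRep g a _

theorem scalarAt_sum {ι : Type*} [Fintype ι]
    (f : ι → (constRep k V ⟶ constRep k V)) (a : V) :
    scalarAt (∑ i, f i) a = ∑ i, scalarAt (f i) a :=
  map_sum (AddMonoidHom.mk' (fun f : constRep k V ⟶ constRep k V => scalarAt f a) fun _ _ => rfl)
    f _

/-- Naturality equates the scalars at the two ends of an arrow, and connectedness spreads this to
all vertices. -/
theorem scalarAt_eq (hV : (underlyingGraph V).Connected) (f : constRep k V ⟶ constRep k V)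
    (a b : V) : scalarAt f a = scalarAt f b :=
  eq_of_connected hV (scalarAt f) (fun α => eval_elementAt f α.toPath) a b

theorem not_isZero_constRep (a : V) : ¬ IsZero (constRep k V) := fun h =>
  one_ne_zero (α := k) (congrArg (scalarAt · a) (h.eq_of_src (𝟙 (constRep k V)) 0))

/-- An indecomposable representation through which a nonzero endomorphism of the constant
representation factors is isomorphic to it. -/
theorem nonempty_iso_constRep (hV : (underlyingGraph V).Connected) {X : QuiverRep k V}
    (hX : Indecomposable X) (s : constRep k V ⟶ X) (t : X ⟶ constRep k V) (a : V)
    (h : scalarAt (s ≫ t) a ≠ 0) : Nonempty (X ≅ constRep k V) := by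
  -- Rescaling by the inverse of the scalar at `a` turns `t` into a retraction of `s`, since the
  -- scalar is the same at every vertex.
  let z : constRep k V ⟶ constRep k V :=
    homMk (fun _ => ((scalarAt (s ≫ t) a)⁻¹ • LinearMap.id : k →ₗ[k] k)) fun _ => rfl
  refine Indecomposable.nonempty_iso_of_retract hX (not_isZero_constRep a) s (t ≫ z) ?_
  rw [← Category.assoc]
  refine hom_ext fun b => LinearMap.ext fun (y : k) => ?_
  have hz : scalarAt z b = (scalarAt (s ≫ t) a)⁻¹ := mul_one _
  have h1 : scalarAt ((s ≫ t) ≫ z) b = 1 := by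
    rw [scalarAt_comp, scalarAt_eq hV (s ≫ t) b a, hz, mul_inv_cancel₀ h]
  have h2 : y * scalarAt ((s ≫ t) ≫ z) b = y := by rw [h1, mul_one]
  exact (appHom_constRep _ b y).trans h2

variable {N : QuiverRep k V} (D : IndecomposableDecomposition N)

theorem IndecomposableDecomposition.total :
    ∑ i, (D.iso.hom ≫ biproduct.π D.summand i) ≫ (biproduct.ι D.summand i ≫ D.iso.inv) = 𝟙 N := by
  have h : ∑ i, biproduct.π D.summand i ≫ biproduct.ι D.summand i = 𝟙 (⨁ D.summand) :=
    biproduct.total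
  calc _ = ∑ i, D.iso.hom ≫ (biproduct.π D.summand i ≫ biproduct.ι D.summand i) ≫ D.iso.inv := by
        simp only [Category.assoc]
    _ = 𝟙 N := by rw [← Preadditive.comp_sum, ← Preadditive.sum_comp, h]; simp

/-- Morphisms from and to the constant representation that compose to the identity matrix are
bounded in number by the summands isomorphic to the constant representation. -/
theorem IndecomposableDecomposition.le_card (hV : (underlyingGraph V).Connected) {r : ℕ}
    (s : Fin r → (constRep k V ⟶ N)) (t : Fin r → (N ⟶ constRep k V)) (a : V)
    (h : ∀ i j, scalarAt (s i ≫ t j) a = if i = j then 1 else 0) :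
    r ≤ Nat.card {i : Fin D.card // Nonempty (D.summand i ≅ constRep k V)} := by
  classical
  let G := {i : Fin D.card // Nonempty (D.summand i ≅ constRep k V)}
  let e : ∀ l : G, D.summand l.1 ≅ constRep k V := fun l => l.2.some
  let A : Matrix (Fin r) G k := fun i l =>
    scalarAt (s i ≫ (D.iso.hom ≫ biproduct.π D.summand l.1) ≫ (e l).hom) a
  let B : Matrix G (Fin r) k := fun l j =>
    scalarAt ((e l).inv ≫ (biproduct.ι D.summand l.1 ≫ D.iso.inv) ≫ t j) a
  have hAB : A * B = 1 := by
    ext i j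
    let f : Fin D.card → (constRep k V ⟶ constRep k V) := fun l =>
      (s i ≫ (D.iso.hom ≫ biproduct.π D.summand l)) ≫
        ((biproduct.ι D.summand l ≫ D.iso.inv) ≫ t j)
    have hf : s i ≫ t j = ∑ l, f l := by
      calc s i ≫ t j = s i ≫ 𝟙 N ≫ t j := by rw [Category.id_comp]
        _ = _ := by
          rw [← D.total, Preadditive.sum_comp, Preadditive.comp_sum]
          simp only [f, Category.assoc]
    -- By `nonempty_iso_constRep`, only summands isomorphic to the constant representation
    -- contribute, so the identity matrix of size `r` factors through a space of dimension `#G`.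
    have hsum : ∑ l, scalarAt (f l) a = ∑ l : G, scalarAt (f l.1) a := by
      rw [← Finset.sum_subtype (Finset.univ.filter fun l =>
        Nonempty (D.summand l ≅ constRep k V)) (by simp) fun l => scalarAt (f l) a]
      refine (Finset.sum_subset (Finset.filter_subset _ _) fun l _ hl => ?_).symm
      by_contra hne
      exact hl (Finset.mem_filter.2 ⟨Finset.mem_univ l,
        nonempty_iso_constRep hV (D.indecomposable l) _ _ a hne⟩)
    rw [Matrix.mul_apply, Matrix.one_apply, ← h i j, hf, scalarAt_sum, hsum]
    refine Finset.sum_congr rfl fun l _ => ?_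
    rw [← scalarAt_comp]
    simp [f]
  have h1 := Matrix.rank_mul_le_left A B
  rw [hAB, Matrix.rank_one, Fintype.card_fin] at h1
  rw [Nat.card_eq_fintype_card]
  exact h1.trans (Matrix.rank_le_card_width A)

/-- The summands isomorphic to the constant representation yield morphisms from and to it that
compose to the identity matrix. -/
theorem IndecomposableDecomposition.exists_dual_families (a : V) :
    ∃ (s : {i : Fin D.card // Nonempty (D.summand i ≅ constRep k V)} → (constRep k V ⟶ N))
      (t : {i : Fin D.card // Nonempty (D.summand i ≅ constRep k V)} → (N ⟶ constRep k V)),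
      ∀ i j, scalarAt (s i ≫ t j) a = if i = j then 1 else 0 := by
  refine ⟨fun l => l.2.some.inv ≫ biproduct.ι D.summand l.1 ≫ D.iso.inv,
    fun l => D.iso.hom ≫ biproduct.π D.summand l.1 ≫ l.2.some.hom, fun i j => ?_⟩
  by_cases h : i = j
  · subst h
    simp
    rfl
  · have h' : i.1 ≠ j.1 := fun h' => h (Subtype.ext h')
    simp [h, biproduct.ι_π_ne_assoc _ h']
    rfl

end ConstRep

/-! ## Tours on courses in a segment -/

/-- The rank of a linear map is the size of an identity matrix that factors through it. -/
theorem exists_dual_families_range {k A B : Type*} [Field k] [AddCommGroup A] [Module k A]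
    [AddCommGroup B] [Module k B] [FiniteDimensional k B] (f : A →ₗ[k] B) :
    ∃ (v : Fin (Module.finrank k (LinearMap.range f)) → A)
      (g : Fin (Module.finrank k (LinearMap.range f)) → B →ₗ[k] k),
      ∀ i j, g j (f (v i)) = if i = j then 1 else 0 := by
  let b := Module.finBasis k (LinearMap.range f)
  choose v hv using fun i => (b i).2
  choose g hg using fun j => LinearMap.exists_extend (b.coord j)
  refine ⟨v, g, fun i j => ?_⟩
  have h := LinearMap.congr_fun (hg j) (b i)
  rw [LinearMap.comp_apply, Submodule.subtype_apply, ← hv] at h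
  rw [h]
  simp [Finsupp.single_apply]

section Tours

variable {k : Type u} [Field k] {V : Type w} [Quiver.{v} V]

open QuiverRep

theorem QuiverRep.eval_eval (M : QuiverRep k V) {a b c : V} (x : Quiver.Path a b)
    (y : Quiver.Path b c) (m : (M.obj a : Type u)) :
    eval M y (eval M x m) = eval M (x.comp y) m :=
  (DFunLike.congr_fun (eval_comp M x y) m).symm

/-- The arbitrary path chosen in `tour` surfaces here, so that path independence can later replace
it by any other. -/
theorem eval_tour_toPath (c : Course.{v, w, v', w'} V) (M : QuiverRep k V) {i j : c.Shape}
    (α : i ⟶ j) :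
    eval (tour c M) α.toPath = eval M (Classical.choice (c.exists_path α)) := by
  have h : (tour c M).map (X := i) (Y := j) α.toPath =
      M.map (X := c.label i) (Y := c.label j) (Classical.choice (c.exists_path α)) :=
    Paths.lift_toPath _ α
  exact congrArg (fun f : M.obj (c.label i) ⟶ M.obj (c.label j) => f.hom.hom) h

/-- If `M` does not distinguish parallel paths and the course `c` stays in a segment and visits its
ends, then the multiplicity of the constant representation in the tour of
`M` is the rank of `M` from the start to the end of the segment. -/
theorem summandMultiplicity_tour (c : Course.{v, w, v', w'} V) (M : QuiverRep k V)
    (hM : ∀ {a b : V} (x y : Quiver.Path a b), eval M x = eval M y)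
    {a b : V} (x : Quiver.Path a b) (h₀ : ∀ i, Nonempty (Quiver.Path a (c.label i)))
    (h₁ : ∀ i, Nonempty (Quiver.Path (c.label i) b)) (ha : a ∈ Set.range c.label)
    (hb : b ∈ Set.range c.label) (L : QuiverRep k c.Shape)
    (hL : Nonempty (L ≅ constRep k c.Shape)) :
    summandMultiplicity (tour c M) L = QuiverRep.rank M x := by
  classical
  obtain ⟨i₀, rfl⟩ := ha
  obtain ⟨i₁, rfl⟩ := hb
  obtain ⟨eL⟩ := hL
  have hne := nonempty_indecomposableDecomposition (tour c M)
  rw [summandMultiplicity, dif_pos hne]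
  set D := hne.some
  have hcongr : ∀ i, Nonempty (D.summand i ≅ L) ↔ Nonempty (D.summand i ≅ constRep k c.Shape) :=
    fun i => ⟨fun ⟨e⟩ => ⟨e ≪≫ eL⟩, fun ⟨e⟩ => ⟨e ≪≫ eL.symm⟩⟩
  rw [Nat.card_congr (Equiv.subtypeEquivRight hcongr)]
  apply le_antisymm
  · obtain ⟨s, t, hst⟩ := D.exists_dual_families i₀
    -- Pushing the elements picked out by `s l` forward to the end of the segment gives a function
    -- constant along the arrows of the course, hence constant even if the course only zigzags from
    -- `i₀` to `i₁`.
    have hs : ∀ l, eval M x (elementAt (s l) i₀) = elementAt (s l) i₁ := by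
      intro l
      have h := eq_of_connected c.connected
        (fun i => eval M (h₁ i).some (elementAt (s l) i)) (fun {i j} α => by
          have hj := eval_elementAt (s l) α.toPath
          rw [eval_tour_toPath] at hj
          exact (DFunLike.congr_fun (hM _ _) _).trans
            ((eval_eval M (Classical.choice (c.exists_path α)) (h₁ j).some _).symm.trans
              (congrArg (eval M (h₁ j).some) hj))) i₀ i₁
      have h' : eval M (h₁ i₁).some = LinearMap.id :=
        (hM _ Quiver.Path.nil).trans (eval_nil M _)
      rw [hM x (h₁ i₀).some]
      refine h.trans ?_
      simp only [h']
      rfl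
    -- The functionals given by `t` are dual to these elements; `scalarAt_eq` moves the pairing from
    -- `i₀` to `i₁`, where the elements lie in the range.
    have hli : LinearIndependent k (fun l =>
        (⟨elementAt (s l) i₁, elementAt (s l) i₀, hs l⟩ : LinearMap.range (eval M x))) := by
      refine LinearIndependent.of_pairwise_dual_eq_zero_one _
        (fun l => (appHom (t l) i₁ : _ →ₗ[k] k) ∘ₗ (LinearMap.range (eval M x)).subtype) ?_ ?_
      · intro i j hij
        have h := hst j i
        rw [scalarAt_eq c.connected _ i₀ i₁, if_neg hij.symm] at h
        exact h
      · intro i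
        have h := hst i i
        rw [scalarAt_eq c.connected _ i₀ i₁, if_pos rfl] at h
        exact h
    rw [Nat.card_eq_fintype_card]
    exact hli.fintype_card_le_finrank
  · obtain ⟨v, g, hvg⟩ := exists_dual_families_range (eval M x)
    -- Vectors at the start are pushed forward and functionals at the end pulled back to every
    -- vertex of the course; path independence makes both families morphisms.
    let s : Fin (QuiverRep.rank M x) → (constRep k c.Shape ⟶ tour c M) := fun i =>
      homMk (fun l => LinearMap.toSpanSingleton k (M.obj (c.label l) : Type u)
        (eval M (h₀ l).some (v i))) (by
        intro l m α
        rw [eval_tour_toPath]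
        refine LinearMap.ext fun (z : k) => ?_
        change z • eval M (h₀ m).some (v i) =
          eval M (Classical.choice (c.exists_path α)) (z • eval M (h₀ l).some (v i))
        rw [map_smul, eval_eval, hM])
    let t : Fin (QuiverRep.rank M x) → (tour c M ⟶ constRep k c.Shape) := fun j =>
      homMk (fun l => g j ∘ₗ eval M (h₁ l).some) (by
        intro l m α
        rw [eval_tour_toPath]
        refine LinearMap.ext fun z => ?_
        change g j (eval M (h₁ m).some (eval M (Classical.choice (c.exists_path α)) z)) =
          g j (eval M (h₁ l).some z)
        exact congrArg (g j) ((eval_eval M _ _ _).trans (DFunLike.congr_fun (hM _ _) _)))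
    refine D.le_card c.connected s t i₀ fun i j => ?_
    refine Eq.trans (congrArg (g j) ?_) (hvg i j)
    -- At `i₀` the composite runs from the start of the segment back to it and on to the end,
    -- parallel to `x`.
    change eval M (h₁ i₀).some ((1 : k) • eval M (h₀ i₀).some (v i)) = _
    rw [one_smul, eval_eval, hM]

end Tours

open QuiverRep

/-! ## Interval representations -/

section IndicatorRep

variable {k : Type u} [Field k] {V : Type w} [Quiver.{v} V]

-- By convexity, a path between vertices of `I` never leaves `I`, so no zero map intervenes. If the
-- last intermediate vertex is outside `I`, then so is `a`, and both sides vanish.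
open Classical in
theorem eval_indicatorRep (I : IntervalSubquiver V) {a b : V} (x : Quiver.Path a b)
    (hb : b ∈ I.verts) (φ : PLift (a ∈ I.verts) → k) :
    (eval (indicatorRep k I.verts) x φ : PLift (b ∈ I.verts) → k) ⟨hb⟩ =
      if h : a ∈ I.verts then φ ⟨h⟩ else 0 := by
  induction x with
  | nil =>
    rw [dif_pos hb]
    rfl
  | @cons c d x α ih =>
    change (if h : c ∈ I.verts then
      (eval (indicatorRep k I.verts) x φ : PLift (c ∈ I.verts) → k) ⟨h⟩ else 0) = _
    by_cases hc : c ∈ I.verts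
    · rw [dif_pos hc, ih hc]
    · rw [dif_neg hc, dif_neg fun ha => hc (I.convex ha hb ⟨x⟩ ⟨α.toPath⟩)]

open Classical in
theorem rank_indicatorRep (I : IntervalSubquiver V) {a b : V} (x : Quiver.Path a b) :
    QuiverRep.rank (indicatorRep k I.verts) x = if a ∈ I.verts ∧ b ∈ I.verts then 1 else 0 := by
  let f : (PLift (a ∈ I.verts) → k) →ₗ[k] (PLift (b ∈ I.verts) → k) :=
    eval (indicatorRep k I.verts) x
  change Module.finrank k (LinearMap.range f) = _
  split_ifs with h
  · have hf : Function.Surjective f := fun ψ => ⟨fun _ => ψ ⟨h.2⟩, by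
      funext ⟨hb⟩
      exact (eval_indicatorRep I x hb _).trans (dif_pos h.1)⟩
    have : Unique (PLift (b ∈ I.verts)) := ⟨⟨⟨h.2⟩⟩, fun _ => rfl⟩
    rw [LinearMap.range_eq_top.2 hf, finrank_top, Module.finrank_fintype_fun_eq_card,
      Fintype.card_unique]
  · have hf : f = 0 := by
      refine LinearMap.ext fun φ => ?_
      funext ⟨hb⟩
      exact (eval_indicatorRep I x hb φ).trans (dif_neg fun ha => h ⟨ha, hb⟩)
    rw [hf, LinearMap.range_zero, finrank_bot]

/-- With all labels in `I`, `eval_indicatorRep` makes every arrow of the course act as the identity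
of `k`, whichever paths were chosen. -/
theorem nonempty_tour_indicatorRep_iso (c : Course.{v, w, v', w'} V) (I : IntervalSubquiver V)
    (h : ∀ i, c.label i ∈ I.verts) :
    Nonempty (tour c (indicatorRep k I.verts) ≅ constRep k c.Shape) := by
  have key : ∀ {i j : c.Shape} (α : i ⟶ j) (φ : PLift (c.label i ∈ I.verts) → k),
      (eval (tour c (indicatorRep k I.verts)) α.toPath φ : PLift (c.label j ∈ I.verts) → k)
        ⟨h j⟩ = φ ⟨h i⟩ := by
    intro i j α φ
    rw [eval_tour_toPath]
    exact (eval_indicatorRep I _ (h j) φ).trans (dif_pos (h i))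
  let f : tour c (indicatorRep k I.verts) ⟶ constRep k c.Shape :=
    homMk (fun i => (LinearMap.proj (PLift.up (h i)) : (PLift (c.label i ∈ I.verts) → k) →ₗ[k] k))
      fun α => LinearMap.ext fun φ => key α φ
  let g : constRep k c.Shape ⟶ tour c (indicatorRep k I.verts) :=
    homMk (fun i => (LinearMap.pi fun _ => LinearMap.id :
        k →ₗ[k] (PLift (c.label i ∈ I.verts) → k)))
      fun {i j} α => LinearMap.ext fun z => by
        funext ⟨hj⟩
        exact (key α fun _ => z).symm
  exact ⟨f, g, hom_ext fun i => LinearMap.ext fun φ => rfl,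
    hom_ext fun i => LinearMap.ext fun z => rfl⟩

end IndicatorRep

/-! ## Segments -/

section Segment

variable {V : Type w} [Quiver.{v} V]

/-- The segment of the vertices between the ends of a path, as an interval. -/
def segment {a b : V} (x : Quiver.Path a b) : IntervalSubquiver V where
  verts := {c | Nonempty (Quiver.Path a c) ∧ Nonempty (Quiver.Path c b)}
  connected := by
    let S : Set V := {c | Nonempty (Quiver.Path a c) ∧ Nonempty (Quiver.Path c b)}
    have ha : a ∈ S := ⟨⟨.nil⟩, ⟨x⟩⟩
    have key : ∀ {c : V} (y : Quiver.Path a c) (hc : c ∈ S),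
        ((underlyingGraph V).induce S).Reachable ⟨a, ha⟩ ⟨c, hc⟩ := by
      intro c y
      induction y with
      | nil => exact fun _ => SimpleGraph.Reachable.refl _
      | @cons c d y α ih =>
        intro hd
        -- Every prefix of the path from `a` still continues to the end `b`, so the path stays in
        -- the segment.
        have hc : c ∈ S := ⟨⟨y⟩, hd.2.map α.toPath.comp⟩
        refine (ih hc).trans ?_
        by_cases hcd : c = d
        · subst hcd
          exact SimpleGraph.Reachable.refl _
        · have hadj : (underlyingGraph V).Adj c d :=
            (SimpleGraph.fromRel_adj _ _ _).2 ⟨hcd, Or.inl ⟨α⟩⟩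
          exact SimpleGraph.Adj.reachable (G := (underlyingGraph V).induce S) hadj
    have : Nonempty S := ⟨⟨a, ha⟩⟩
    refine ⟨fun c d => ?_⟩
    exact (key c.2.1.some c.2).symm.trans (key d.2.1.some d.2)
  convex := by
    rintro c d e ⟨⟨hc⟩, -⟩ ⟨-, ⟨he⟩⟩ ⟨y⟩ ⟨z⟩
    exact ⟨⟨hc.comp y⟩, ⟨z.comp he⟩⟩

variable {a b : V} (x : Quiver.Path a b)

/-- This is where convexity of `J` matches the summation condition `segment x ≤ J` with the support
of the rank of `V_J` along `x`. -/
theorem segment_le_iff (J : IntervalSubquiver V) :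
    segment x ≤ J ↔ a ∈ J.verts ∧ b ∈ J.verts :=
  ⟨fun h => ⟨h ⟨⟨.nil⟩, ⟨x⟩⟩, h ⟨⟨x⟩, ⟨.nil⟩⟩⟩,
    fun h _ hc => J.convex h.1 h.2 hc.1 hc.2⟩

/-- In a quiver without oriented cycles, the essential vertices of a segment are its ends. -/
theorem essential_segment (hV : ∀ {c d : V}, (c ⟶ d) → IsEmpty (Quiver.Path d c)) :
    (segment x).essential = {a, b} := by
  ext c
  constructor
  · rintro (⟨⟨⟨y⟩, ⟨z⟩⟩, h⟩ | ⟨⟨⟨y⟩, ⟨z⟩⟩, h⟩)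
    · cases y with
      | nil => exact Or.inl rfl
      | cons y α => exact ((h _ ⟨⟨y⟩, ⟨α.toPath.comp z⟩⟩).false α).elim
    -- Paths grow at their end, so the first arrow, which a sink forbids, is extracted through the
    -- length.
    · rcases hn : z.length with _ | n
      · exact Or.inr (Quiver.Path.eq_of_length_zero z hn)
      · obtain ⟨d, α, z, -, -⟩ := Quiver.Path.eq_toPath_comp_of_length_eq_succ z hn
        exact ((h d ⟨⟨y.comp α.toPath⟩, ⟨z⟩⟩).false α).elim
  · rintro (rfl | rfl)
    · exact Or.inl ⟨⟨⟨.nil⟩, ⟨x⟩⟩, fun d hd => ⟨fun α => (hV α).false hd.1.some⟩⟩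
    · exact Or.inr ⟨⟨⟨x⟩, ⟨.nil⟩⟩, fun d hd => ⟨fun α => (hV α).false hd.2.some⟩⟩

theorem segment_mem_essentialIntervalsLE
    (hV : ∀ {c d : V}, (c ⟶ d) → IsEmpty (Quiver.Path d c)) :
    segment x ∈ essentialIntervalsLE V 2 := by
  -- The number of essential vertices is one if `a = b` and two otherwise.
  refine Set.mem_biUnion (x := (segment x).essential.ncard) ?_ rfl
  rw [essential_segment x hV]
  exact ⟨(Set.ncard_pos).2 ⟨a, Or.inl rfl⟩, (Set.ncard_insert_le a {b}).trans (by simp)⟩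

end Segment

/-! ## Paths in grids -/

section Grid

variable {p q : ℕ}

/-- The coordinate sum is a height raised by one along each arrow. It rules out oriented cycles and
forces parallel paths to have equal length. -/
theorem Grid.le_of_hom {a b : Grid p q} (α : a ⟶ b) :
    a.fst.pos ≤ b.fst.pos ∧ a.snd.pos ≤ b.snd.pos ∧
      a.fst.pos.val + a.snd.pos.val + 1 = b.fst.pos.val + b.snd.pos.val := by
  change QuiverProd.Arrow a b at α
  cases α with
  | left α c =>
    have := α.down
    exact ⟨Fin.le_def.2 (by dsimp only; omega), le_rfl, by dsimp only; omega⟩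
  | right c α =>
    have := α.down
    exact ⟨le_rfl, Fin.le_def.2 (by dsimp only; omega), by dsimp only; omega⟩

theorem Grid.le_of_path {a b : Grid p q} (x : Quiver.Path a b) :
    a.fst.pos ≤ b.fst.pos ∧ a.snd.pos ≤ b.snd.pos ∧
      a.fst.pos.val + a.snd.pos.val + x.length = b.fst.pos.val + b.snd.pos.val := by
  induction x with
  | nil => exact ⟨le_rfl, le_rfl, rfl⟩
  | cons x α ih =>
    have h := Grid.le_of_hom α
    exact ⟨ih.1.trans h.1, ih.2.1.trans h.2.1, by rw [Quiver.Path.length_cons]; omega⟩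

theorem Grid.isEmpty_path_of_hom {a b : Grid p q} (α : a ⟶ b) : IsEmpty (Quiver.Path b a) :=
  ⟨fun x => by
    have h₁ := Grid.le_of_path x
    have h₂ := Grid.le_of_hom α
    omega⟩

instance {n : ℕ} (i j : LinearQuiver n) : Subsingleton (i ⟶ j) :=
  ⟨fun ⟨_⟩ ⟨_⟩ => rfl⟩

theorem LinearQuiver.nonempty_path {n : ℕ} {i j : LinearQuiver n} (h : i.pos ≤ j.pos) :
    Nonempty (Quiver.Path i j) := by
  obtain ⟨⟨i, hi⟩⟩ := i
  obtain ⟨⟨j, hj⟩⟩ := j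
  replace h : i ≤ j := h
  induction j, h using Nat.le_induction with
  | base => exact ⟨.nil⟩
  | succ j _ ih =>
    obtain ⟨x⟩ := ih (by omega)
    exact ⟨x.cons ⟨rfl⟩⟩

theorem Grid.nonempty_path {a b : Grid p q} (h₁ : a.fst.pos ≤ b.fst.pos)
    (h₂ : a.snd.pos ≤ b.snd.pos) : Nonempty (Quiver.Path a b) := by
  obtain ⟨a₁, a₂⟩ := a
  obtain ⟨b₁, b₂⟩ := b
  obtain ⟨x⟩ := LinearQuiver.nonempty_path h₁
  obtain ⟨y⟩ := LinearQuiver.nonempty_path h₂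
  let F : LinearQuiver p ⥤q Grid p q :=
    { obj := fun i => ⟨i, a₂⟩, map := fun α => QuiverProd.Arrow.left α a₂ }
  let G : LinearQuiver q ⥤q Grid p q :=
    { obj := fun i => ⟨b₁, i⟩, map := fun α => QuiverProd.Arrow.right b₁ α }
  exact ⟨(F.mapPath x).comp (G.mapPath y)⟩

variable {k : Type u} [Field k]

/-- A representation of the commutative grid does not distinguish parallel paths. -/
theorem GridRep.eval_eq (M : GridRep k p q) {a b : Grid p q} (x y : Quiver.Path a b) :
    eval M.toRep x = eval M.toRep y := by
  -- The last arrows of the two paths are compared: with the same direction they coincide and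
  -- induction applies; otherwise they are two sides of a commutative square.
  induction hn : x.length generalizing b with
  | zero =>
    have hx := Grid.le_of_path x
    have hy := Grid.le_of_path y
    cases x with
    | cons x α => simp at hn
    | nil =>
      cases y with
      | nil => rfl
      | cons y β => rw [Quiver.Path.length_cons] at hy; omega
  | succ n ih =>
    have hx := Grid.le_of_path x
    have hy := Grid.le_of_path y
    have comp_eval : ∀ {c d : Grid p q} (z z' : Quiver.Path a c) (γ : c ⟶ d),
        eval M.toRep z = eval M.toRep z' → eval M.toRep (z.cons γ) = eval M.toRep (z'.cons γ) := by
      intro c d z z' γ h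
      exact (eval_comp _ z γ.toPath).trans ((congrArg _ h).trans (eval_comp _ z' γ.toPath).symm)
    have square : ∀ {c₁ d₁ : LinearQuiver p} {c₂ d₂ : LinearQuiver q} (α : c₁ ⟶ d₁) (β : c₂ ⟶ d₂)
        (x : Quiver.Path a ⟨c₁, d₂⟩) (y : Quiver.Path a ⟨d₁, c₂⟩), x.length = n → y.length = n →
        eval M.toRep (x.cons (QuiverProd.Arrow.left α d₂ : _ ⟶ _)) =
          eval M.toRep (y.cons (QuiverProd.Arrow.right d₁ β : _ ⟶ _)) := by
      intro c₁ d₁ c₂ d₂ α β x y hx hy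
      -- The corner opposite the endpoint of the square is reachable from `a`: `x` bounds its first
      -- coordinate and `y` its second. Both paths are rerouted through it by induction.
      obtain ⟨z⟩ : Nonempty (Quiver.Path a ⟨c₁, c₂⟩) :=
        Grid.nonempty_path (Grid.le_of_path x).1 (Grid.le_of_path y).2.1
      refine (comp_eval x (z.cons (QuiverProd.Arrow.right c₁ β : _ ⟶ _)) _ (ih _ _ hx)).trans ?_
      refine Eq.trans ?_
        (comp_eval y (z.cons (QuiverProd.Arrow.left α c₂ : _ ⟶ _)) _ (ih _ _ hy)).symm
      exact (eval_comp _ z (QuiverProd.rightLeft α β)).trans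
        ((congrArg (· ∘ₗ eval M.toRep z) (M.comm α β).symm).trans
          (eval_comp _ z (QuiverProd.leftRight α β)).symm)
    have pred : ∀ {n : ℕ} {i j l : LinearQuiver n} (α : i ⟶ l) (β : j ⟶ l), i = j := by
      rintro n ⟨i⟩ ⟨j⟩ l ⟨α⟩ ⟨β⟩
      have : i = j := Fin.ext (by dsimp only at α β; omega)
      rw [this]
    cases x with
    | nil => simp at hn
    | cons x α =>
      cases y with
      | nil => rw [Quiver.Path.length_nil] at hy; omega
      | cons y β =>
        rw [Quiver.Path.length_cons] at hn hx hy
        change QuiverProd.Arrow _ _ at α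
        change QuiverProd.Arrow _ _ at β
        cases α with
        | left α c =>
          cases β with
          | left β _ =>
            obtain rfl := pred α β
            obtain rfl := Subsingleton.elim α β
            exact comp_eval x y _ (ih x y (by omega))
          | right _ β => exact square α β x y (by omega) (by omega)
        | right c α =>
          cases β with
          | left β _ => exact (square β α y x (by omega) (by omega)).symm
          | right _ β =>
            obtain rfl := pred α β
            obtain rfl := Subsingleton.elim α β
            exact comp_eval x y _ (ih x y (by omega))

end Grid

/-! ## Rank invariance -/

section RankInvariance

variable {k : Type u} [Field k] {p q : ℕ} {S : Set (IntervalSubquiver (Grid p q))}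

theorem compressedMultiplicity_segment (ξ : EssentialAssignment.{_, _, v', w'} S)
    (M : GridRep k p q) {a b : Grid p q} (x : Quiver.Path a b) (hS : segment x ∈ S) :
    compressedMultiplicity ξ M ⟨segment x, hS⟩ = QuiverRep.rank M.toRep x := by
  obtain ⟨h₁, h₂⟩ := ξ.essential ⟨segment x, hS⟩
  rw [essential_segment x Grid.isEmpty_path_of_hom] at h₁
  exact summandMultiplicity_tour _ M.toRep M.eval_eq x (fun i => (h₂ ⟨i, rfl⟩).1)
    (fun i => (h₂ ⟨i, rfl⟩).2) (h₁ (Or.inl rfl)) (h₁ (Or.inr rfl)) _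
    (nonempty_tour_indicatorRep_iso _ _ fun i => h₂ ⟨i, rfl⟩)

/-- If all intervals with at most two essential vertices are taken into account, then partial
interval approximations preserve the rank invariant. -/
theorem IsPartialIntervalApproximation.isRankInvariant {ξ : EssentialAssignment.{_, _, v', w'} S}
    {M : GridRep k p q} {δ : S → ℤ} (hδ : IsPartialIntervalApproximation ξ M δ)
    (hS : essentialIntervalsLE (Grid p q) 2 ⊆ S) : IsRankInvariant M δ := by
  classical
  intro a b x
  have hx : segment x ∈ S := hS (segment_mem_essentialIntervalsLE x Grid.isEmpty_path_of_hom)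
  -- The approximation equation at the segment becomes a sum over all of `S` with an indicator,
  -- which is matched with the rank formula term by term.
  rw [← compressedMultiplicity_segment ξ M x hx, hδ ⟨segment x, hx⟩, Finset.sum_filter]
  refine Finset.sum_congr rfl fun J _ => ?_
  have h : QuiverRep.rank (intervalRep k J.1).toRep x =
      if a ∈ J.1.verts ∧ b ∈ J.1.verts then 1 else 0 := rank_indicatorRep J.1 x
  rw [h]
  simp only [segment_le_iff]
  split_ifs <;> simp

end RankInvariance

end IntervalApprox
end

theorem mainTheorem4 (k : Type u) [Field k] (p q : ℕ)
    (M : IntervalApprox.GridRep k p q) :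
    (∀ (S : Set (IntervalApprox.IntervalSubquiver (IntervalApprox.Grid p q)))
        (ξ : IntervalApprox.EssentialAssignment.{0, 0, v', w'} S) (δ : S → ℤ),
        IntervalApprox.essentialIntervalsLE (IntervalApprox.Grid p q) 2 ⊆ S →
        IntervalApprox.IsPartialIntervalApproximation ξ M δ →
          IntervalApprox.IsRankInvariant M δ) ∧
      ∀ (ξ : IntervalApprox.EssentialAssignment.{0, 0, v', w'}
          (IntervalApprox.essentialIntervalsLE (IntervalApprox.Grid p q) 2))
        (δ : IntervalApprox.essentialIntervalsLE (IntervalApprox.Grid p q) 2 → ℤ),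
        IntervalApprox.IsRectangleApproximation ξ M δ →
          IntervalApprox.IsRankInvariant M δ :=
  ⟨fun _ _ _ hS hδ => hδ.isRankInvariant hS,
    fun _ _ hδ => IntervalApprox.IsPartialIntervalApproximation.isRankInvariant hδ subset_rfl⟩
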